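/- Let $k\ge 1$. The infinite $k$-star $\operatorname{instar}(k)$ consists of a center $v_{1,0}=\dots=v_{k,0}$ and $k$ ordered branches, branch $i\in\{1,\dots,k\}$ having vertices $v_{i,1},v_{i,2},\dots$, with $v_{i,j}$ adjacent to $v_{i,j+1}$ for all $i$ and all $j\ge 0$. Chips labeled $1,\dots,N$ are placed on the vertices; $\mathcal C(v)$ denotes the set of labels of the chips on $v$ in the configuration $\mathcal C$. Firing the center means choosing $k$ chips $n_1<\dots<n_k$ on it and moving chip $n_i$ to $v_{i,1}$ for each $i$; firing $v_{i,j}$ with $j\ge 1$ means choosing two chips $a<b$ on it and moving $a$ to $v_{i,j-1}$ and $b$ to $v_{i,j+1}$. A configuration is stable if every vertex $v$ carries fewer than $\deg(v)$ chips. Let $\Delta^{k,2}$ be the configuration with the chips $1,\dots,2k$ all on the center, and let $\mathcal T^{k,2}$ be the set of stable configurations reachable from $\Delta^{k,2}$ by finitely many fires. A standard Young tableau of shape $(2)^k$ is a filling $Y=(y_{i,j})_{1\le i\le k,\ 1\le j\le 2}$ that uses each of the numbers $1,\dots,2k$ exactly once and is strictly increasing along rows (in $j$) and down columns (in $i$).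 Theorem. There is a bijection $\varphi$ from $\mathcal T^{k,2}$ to the set of standard Young tableaux of shape $(2)^k$ such that, for every $\mathcal C\in\mathcal T^{k,2}$, the tableau $\varphi(\mathcal C)=(y_{i,j})$ satisfies $\mathcal C(v_{i,j})=\{y_{i,j}\}$ for all $1\le i\le k$ and $1\le j\le 2$. Its inverse sends a standard Young tableau $Y=(y_{i,j})$ to the configuration $\mathcal C$ with $\mathcal C(v_{i,j})=\{y_{i,j}\}$ for $1\le i\le k$, $1\le j\le 2$, and $\mathcal C(v)=\emptyset$ for every other vertex $v$. Hence both the standard Young tableaux of shape $(2)^k$ and the configurations in $\mathcal T^{k,2}$ are counted by the Catalan number: $|\mathcal T^{k,2}|=C_k=\frac{1}{k+1}\binom{2k}{k}$. -/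

import Mathlib

namespace StarChip

/-! ### The infinite `k`-star -/

/-- Vertices of the infinite `k`-star: the center, and on each of the `k` branches the vertices
`branch i j` at distance `j + 1` from the center. Branches are indexed by `Fin k`, in order. -/
inductive Vertex (k : ℕ) : Type
  | center : Vertex k
  | branch (i : Fin k) (j : ℕ) : Vertex k

/-- `vert i j` is the vertex of level `j` on branch `i`; for `j = 0` it is the center, whatever
the branch `i`. -/
def vert {k : ℕ} (i : Fin k) : ℕ → Vertex k
  | 0 => Vertex.center
  | j + 1 => Vertex.branch i j

/-- The infinite `k`-star graph: on every branch, consecutive levels are joined by an edge. -/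
def instar (k : ℕ) : SimpleGraph (Vertex k) :=
  SimpleGraph.fromRel fun u w => ∃ (i : Fin k) (j : ℕ), u = vert i j ∧ w = vert i (j + 1)

/-- The degree of a vertex: its number of neighbors in the infinite `k`-star. -/
noncomputable def deg {k : ℕ} (v : Vertex k) : ℕ := ((instar k).neighborSet v).ncard

theorem vert_succ_inj {k : ℕ} {i i' : Fin k} {j j' : ℕ} (h : vert i (j + 1) = vert i' (j' + 1)) :
    i = i' ∧ j = j' := by
  simpa [vert] using h

theorem deg_center (k : ℕ) : deg (Vertex.center : Vertex k) = k := by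
  have h : (instar k).neighborSet Vertex.center = Set.range fun i : Fin k => vert i 1 := by
    ext w
    simp only [instar, SimpleGraph.mem_neighborSet, SimpleGraph.fromRel_adj, Set.mem_range]
    constructor
    · rintro ⟨_, ⟨i, j, h1, h2⟩ | ⟨i, j, _, h2⟩⟩
      · cases j with
        | zero => exact ⟨i, h2.symm⟩
        | succ j => simp [vert] at h1
      · simp [vert] at h2
    · rintro ⟨i, rfl⟩
      exact ⟨by simp [vert], Or.inl ⟨i, 0, rfl, rfl⟩⟩
  have hinj : Function.Injective fun i : Fin k => vert i 1 := fun _ _ e => (vert_succ_inj e).1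
  rw [deg, h, ← Set.image_univ, Set.ncard_image_of_injective _ hinj, Set.ncard_univ,
    Nat.card_eq_fintype_card, Fintype.card_fin]

theorem deg_branch {k : ℕ} (i : Fin k) (j : ℕ) : deg (vert i (j + 1)) = 2 := by
  have h : (instar k).neighborSet (vert i (j + 1)) = {vert i j, vert i (j + 2)} := by
    ext w
    simp only [instar, SimpleGraph.mem_neighborSet, SimpleGraph.fromRel_adj, Set.mem_insert_iff,
      Set.mem_singleton_iff]
    constructor
    · rintro ⟨_, ⟨i', j', h1, h2⟩ | ⟨i', j', h1, h2⟩⟩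
      · cases j' with
        | zero => simp [vert] at h1
        | succ j' =>
          obtain ⟨rfl, rfl⟩ := vert_succ_inj h1
          exact Or.inr h2
      · obtain ⟨rfl, rfl⟩ := vert_succ_inj h2
        exact Or.inl h1
    · rintro (rfl | rfl)
      · exact ⟨by cases j <;> simp [vert], Or.inr ⟨i, j, rfl, rfl⟩⟩
      · exact ⟨by simp [vert], Or.inl ⟨i, j + 1, rfl, rfl⟩⟩
  rw [deg, h, Set.ncard_pair]
  cases j <;> simp [vert]

/-! ### Labeled chip-firing -/

/-- The chips, labeled by the numbers `1, …, N`. -/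
abbrev Chip (N : ℕ) : Type := Set.Icc 1 N

/-- A labeled chip configuration with chips `1, …, N`: every chip sits on one vertex. -/
abbrev Config (k N : ℕ) : Type := Chip N → Vertex k

/-- The set of labels of the chips that sit on the vertex `v`. -/
def chipsAt {k N : ℕ} (C : Config k N) (v : Vertex k) : Set ℕ :=
  {n : ℕ | ∃ h : n ∈ Set.Icc 1 N, C ⟨n, h⟩ = v}

/-- `Fire C C'`: the configuration `C'` arises from `C` by firing one vertex once.

* Firing the center: `k` chips `n 1 < ⋯ < n k` on the center are chosen, and chip `n i` moves to
  level `1` of branch `i`.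
* Firing the vertex of level `j + 1` on branch `i`: two chips `a < b` on it are chosen, chip `a`
  moves to level `j` and chip `b` moves to level `j + 2` of branch `i`.

All chips which are not chosen stay where they are. -/
inductive Fire {k N : ℕ} : Config k N → Config k N → Prop
  | center (C C' : Config k N) (n : Fin k → Chip N) (hn : StrictMono n)
      (hC : ∀ i, C (n i) = Vertex.center)
      (hmove : ∀ i, C' (n i) = vert i 1)
      (hstay : ∀ c, (∀ i, c ≠ n i) → C' c = C c) : Fire C C'
  | branch (C C' : Config k N) (i : Fin k) (j : ℕ) (a b : Chip N) (hab : a < b)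
      (ha : C a = vert i (j + 1)) (hb : C b = vert i (j + 1))
      (hmovea : C' a = vert i j) (hmoveb : C' b = vert i (j + 2))
      (hstay : ∀ c, c ≠ a → c ≠ b → C' c = C c) : Fire C C'

/-- `C'` is reachable from `C` by a finite sequence of fires. -/
def Reachable {k N : ℕ} (C C' : Config k N) : Prop := Relation.ReflTransGen Fire C C'

/-- A configuration is stable if every vertex holds fewer chips than its degree. -/
def Stable {k N : ℕ} (C : Config k N) : Prop := ∀ v : Vertex k, (chipsAt C v).ncard < deg v

/-- The starting configuration `Δ^{k,m}`: the chips `1, …, k m` all sit on the center. -/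
def start (k m : ℕ) : Config k (k * m) := fun _ => Vertex.center

/-- The set `𝒯^{k,m}` of the stable configurations reachable from `Δ^{k,m}`. -/
def stableConfigs (k m : ℕ) : Set (Config k (k * m)) :=
  {C | Reachable (start k m) C ∧ Stable C}

/-! ### Standard Young tableaux -/

/-- A standard Young tableau of shape `μ`: a filling of the cells of `μ` in which each of the
numbers `1, …, |μ|` is used exactly once, and whose rows and columns are strictly increasing.
Rows and columns are numbered from `0`; the entries outside `μ` are set to `0`, so that equal
fillings are equal tableaux. -/
@[ext]
structure StandardYoungTableau (μ : YoungDiagram) where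
  entry : ℕ → ℕ → ℕ
  bijOn : Set.BijOn (fun c : ℕ × ℕ => entry c.1 c.2) (μ.cells : Set (ℕ × ℕ)) (Set.Icc 1 μ.card)
  row_strict : ∀ {i j₁ j₂ : ℕ}, j₁ < j₂ → (i, j₂) ∈ μ → entry i j₁ < entry i j₂
  col_strict : ∀ {i₁ i₂ j : ℕ}, i₁ < i₂ → (i₂, j) ∈ μ → entry i₁ j < entry i₂ j
  zeros : ∀ {i j : ℕ}, (i, j) ∉ μ → entry i j = 0

/-- The rectangular Young diagram `(m)^k = (m, …, m)` with `k` rows of length `m`. -/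
def rect (k m : ℕ) : YoungDiagram :=
  YoungDiagram.ofRowLens (List.replicate k m) (List.sortedGE_iff_pairwise.2 (by simp [List.pairwise_replicate]))

theorem mem_rect {k m i j : ℕ} : (i, j) ∈ rect k m ↔ i < k ∧ j < m := by
  simp [rect, YoungDiagram.mem_ofRowLens]

end StarChip

namespace StarChip

/-! The firing process is almost forced. From `start k 2` only the center can fire; afterwards each
branch holds one chip, so the center must fire again. Let `s` and `n` be the increasing sequences of
chips sent out by these two fires. Branch `i` now holds `s i` and `n i` on level 1. The sequences
`min (s i) (n i)` and `max (s i) (n i)` both increase in `i`, so they are the columns of a standard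
tableau. Each branch then fires once, in any order, sending its smaller chip to the center and its
larger one to level 2. The center has `k` chips again only when all branches have fired, and its
last fire sorts the smaller chips back to their own branches. Then nothing can fire.

`Stage` records these phases: `Stage.fire` shows that fires stay within them, and
`Stage.exists_isFinal` that only the last one is stable. Conversely, firing the two columns of a
tableau from the center leads to that tableau (`TwoColumn.reachable_of_isFinal`).

For the count, the first column gives the up-steps and the second the down-steps of a word of length
`2k`; the row inequalities say exactly that the word is a Dyck word. -/

theorem center_ne_vert {k : ℕ} (i : Fin k) (j : ℕ) : (Vertex.center : Vertex k) ≠ vert i (j + 1) := by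
  simp [vert]

theorem card_chip (N : ℕ) : Fintype.card (Chip N) = N := by
  simp

theorem le_ncard_chipsAt {k N m : ℕ} {C : Config k N} {v : Vertex k} (f : Fin m → Chip N)
    (hf : Function.Injective f) (h : ∀ i, C (f i) = v) : m ≤ (chipsAt C v).ncard := by
  have hinj : Function.Injective fun i => (f i : ℕ) := Subtype.val_injective.comp hf
  have hfin : (chipsAt C v).Finite := (Set.finite_Icc 1 N).subset fun n hn => hn.1
  calc m = (Set.range fun i => (f i : ℕ)).ncard := by
        rw [← Set.image_univ, Set.ncard_image_of_injective _ hinj, Set.ncard_univ,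
          Nat.card_eq_fintype_card, Fintype.card_fin]
    _ ≤ _ := Set.ncard_le_ncard (by rintro _ ⟨i, rfl⟩; exact ⟨(f i).2, h i⟩) hfin

/-- The rows `fst i < snd i` of a standard filling of the shape `(2)^k`, as chips. -/
@[ext]
structure TwoColumn (k : ℕ) where
  fst : Fin k → Chip (k * 2)
  snd : Fin k → Chip (k * 2)
  fst_mono : StrictMono fst
  snd_mono : StrictMono snd
  fst_lt_snd : ∀ i, fst i < snd i
  fst_ne_snd : ∀ i j, fst i ≠ snd j

/-! ### Two-column fillings and the final configurations they describe -/

namespace TwoColumn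

variable {k : ℕ}

/-- Pigeonhole: `k + k` distinct chips exhaust all `k * 2` chips. -/
theorem exists_eq_or_of_injective {s t : Fin k → Chip (k * 2)} (hs : Function.Injective s)
    (ht : Function.Injective t) (hst : ∀ i j, s i ≠ t j) (c : Chip (k * 2)) :
    (∃ i, s i = c) ∨ ∃ i, t i = c := by
  have hinj : Function.Injective (Sum.elim s t) := hs.sumElim ht hst
  obtain ⟨i | i, h⟩ := ((Fintype.bijective_iff_injective_and_card (Sum.elim s t)).2
    ⟨hinj, by rw [card_chip]; simp [mul_two]⟩).2 c
  · exact Or.inl ⟨i, h⟩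
  · exact Or.inr ⟨i, h⟩

theorem cover (T : TwoColumn k) (c : Chip (k * 2)) : (∃ i, T.fst i = c) ∨ ∃ i, T.snd i = c :=
  exists_eq_or_of_injective T.fst_mono.injective T.snd_mono.injective T.fst_ne_snd c

theorem config_ext (T : TwoColumn k) {C C' : Config k (k * 2)}
    (h₁ : ∀ i, C (T.fst i) = C' (T.fst i)) (h₂ : ∀ i, C (T.snd i) = C' (T.snd i)) : C = C' := by
  funext c
  obtain ⟨i, rfl⟩ | ⟨i, rfl⟩ := T.cover c
  · exact h₁ i
  · exact h₂ i

open Classical in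
/-- The configuration with the chips `fst i` on `f i` and the chips `snd i` on `g i`. -/
noncomputable def place (T : TwoColumn k) (f g : Fin k → Vertex k) : Config k (k * 2) := fun c =>
  if h : ∃ i, T.fst i = c then f h.choose else
    if h : ∃ i, T.snd i = c then g h.choose else Vertex.center

@[simp]
theorem place_fst (T : TwoColumn k) (f g : Fin k → Vertex k) (i : Fin k) :
    T.place f g (T.fst i) = f i := by
  have h : ∃ j, T.fst j = T.fst i := ⟨i, rfl⟩
  rw [place, dif_pos h, T.fst_mono.injective h.choose_spec]

@[simp]
theorem place_snd (T : TwoColumn k) (f g : Fin k → Vertex k) (i : Fin k) :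
    T.place f g (T.snd i) = g i := by
  have h : ∃ j, T.snd j = T.snd i := ⟨i, rfl⟩
  rw [place, dif_neg (fun ⟨j, hj⟩ => T.fst_ne_snd j i hj), dif_pos h,
    T.snd_mono.injective h.choose_spec]

/-- The chips `fst i` and `snd i` sit on levels `1` and `2` of branch `i`. -/
def IsFinal (T : TwoColumn k) (C : Config k (k * 2)) : Prop :=
  ∀ i, C (T.fst i) = vert i 1 ∧ C (T.snd i) = vert i 2

theorem chipsAt_of_isFinal {T : TwoColumn k} {C : Config k (k * 2)} (h : T.IsFinal C) (i : Fin k)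
    (j : ℕ) : chipsAt C (vert i j) =
      if j = 1 then {(T.fst i : ℕ)} else if j = 2 then {(T.snd i : ℕ)} else ∅ := by
  ext n
  have key : n ∈ chipsAt C (vert i j) ↔
      (j = 1 ∧ n = T.fst i) ∨ (j = 2 ∧ n = T.snd i) := by
    constructor
    · rintro ⟨hn, hC⟩
      obtain ⟨i', h'⟩ | ⟨i', h'⟩ := T.cover ⟨n, hn⟩
      · rw [← h', (h i').1] at hC
        obtain _ | j := j
        · exact absurd hC.symm (center_ne_vert _ _)
        · obtain ⟨rfl, rfl⟩ := vert_succ_inj hC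
          exact Or.inl ⟨rfl, by rw [h']⟩
      · rw [← h', (h i').2] at hC
        obtain _ | j := j
        · exact absurd hC.symm (center_ne_vert _ _)
        · obtain ⟨rfl, rfl⟩ := vert_succ_inj hC
          exact Or.inr ⟨rfl, by rw [h']⟩
    · rintro (⟨rfl, rfl⟩ | ⟨rfl, rfl⟩)
      · exact ⟨(T.fst i).2, (h i).1⟩
      · exact ⟨(T.snd i).2, (h i).2⟩
  rw [key]
  split_ifs with h1 h2 <;> simp_all

theorem stable_of_isFinal {T : TwoColumn k} {C : Config k (k * 2)} (hk : 1 ≤ k)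
    (h : T.IsFinal C) : Stable C := by
  rintro (_ | ⟨i, j⟩)
  · rw [deg_center]
    have := chipsAt_of_isFinal h ⟨0, hk⟩ 0
    simp only [vert] at this
    simpa [this] using Nat.pos_of_ne_zero (by omega)
  · change (chipsAt C (vert i (j + 1))).ncard < deg (vert i (j + 1))
    rw [deg_branch, chipsAt_of_isFinal h]
    split_ifs <;> simp

theorem IsFinal.injective {T T' : TwoColumn k} {C : Config k (k * 2)} (h : T.IsFinal C)
    (h' : T'.IsFinal C) : T = T' := by
  ext i
  · have := (chipsAt_of_isFinal h i 1).symm.trans (chipsAt_of_isFinal h' i 1)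
    simpa using this
  · have := (chipsAt_of_isFinal h i 2).symm.trans (chipsAt_of_isFinal h' i 2)
    simpa using this

/-- The configuration in which the chips with `i < m` have already been fired from level `1`. -/
noncomputable def partialConfig (T : TwoColumn k) (m : ℕ) : Config k (k * 2) :=
  T.place (fun i => if (i : ℕ) < m then Vertex.center else vert i 1)
    (fun i => if (i : ℕ) < m then vert i 2 else vert i 1)

/-- The row inequality `fst < snd` decides which chip of branch `m` returns to the center. -/
theorem fire_partialConfig (T : TwoColumn k) {m : ℕ} (hm : m < k) :
    Fire (T.partialConfig m) (T.partialConfig (m + 1)) := by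
  refine Fire.branch _ _ ⟨m, hm⟩ 0 (T.fst ⟨m, hm⟩) (T.snd ⟨m, hm⟩) (T.fst_lt_snd _)
    (by simp [partialConfig]) (by simp [partialConfig]) (by simp [partialConfig, vert])
    (by simp [partialConfig]) fun c hc₁ hc₂ => ?_
  obtain ⟨i, rfl⟩ | ⟨i, rfl⟩ := T.cover c
  · have hi : (i : ℕ) ≠ m := fun e => hc₁ (by rw [Fin.ext (a := i) (b := ⟨m, hm⟩) e])
    have : ((i : ℕ) < m + 1) ↔ (i : ℕ) < m := by omega
    simp only [partialConfig, place_fst, this]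
  · have hi : (i : ℕ) ≠ m := fun e => hc₂ (by rw [Fin.ext (a := i) (b := ⟨m, hm⟩) e])
    have : ((i : ℕ) < m + 1) ↔ (i : ℕ) < m := by omega
    simp only [partialConfig, place_snd, this]

theorem reachable_partialConfig (T : TwoColumn k) {m : ℕ} (hm : m ≤ k) :
    Reachable (start k 2) (T.partialConfig m) := by
  induction m with
  | zero =>
    have h₁ : Fire (start k 2) (T.place (fun i => vert i 1) fun _ => Vertex.center) := by
      refine Fire.center _ _ T.fst T.fst_mono (fun _ => rfl) (by simp) fun c hc => ?_
      obtain ⟨i, rfl⟩ | ⟨i, rfl⟩ := T.cover c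
      · exact absurd rfl (hc i)
      · simp [start]
    have h₂ : Fire (T.place (fun i => vert i 1) fun _ => Vertex.center) (T.partialConfig 0) := by
      refine Fire.center _ _ T.snd T.snd_mono (by simp) (by simp [partialConfig]) fun c hc => ?_
      obtain ⟨i, rfl⟩ | ⟨i, rfl⟩ := T.cover c
      · simp [partialConfig]
      · exact absurd rfl (hc i)
    exact (Relation.ReflTransGen.single h₁).tail h₂
  | succ m ih => exact (ih (by omega)).tail (T.fire_partialConfig hm)

theorem reachable_of_isFinal {T : TwoColumn k} {C : Config k (k * 2)} (h : T.IsFinal C) :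
    Reachable (start k 2) C := by
  -- At `m = k` all of `fst` is back on the center, and one more fire finishes.
  refine (T.reachable_partialConfig le_rfl).tail ?_
  refine Fire.center _ _ T.fst T.fst_mono (by simp [partialConfig]) (fun i => (h i).1)
    fun c hc => ?_
  obtain ⟨i, rfl⟩ | ⟨i, rfl⟩ := T.cover c
  · exact absurd rfl (hc i)
  · simp [partialConfig, (h i).2]

theorem isFinal_place (T : TwoColumn k) : T.IsFinal (T.place (vert · 1) (vert · 2)) := by
  simp [IsFinal]

end TwoColumn

/-- The configurations that occur when firing from `Δ^{k,2}`. -/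
inductive Stage {k : ℕ} (C : Config k (k * 2)) : Prop
  | initial (h : ∀ c, C c = Vertex.center) : Stage C
  | once (s : Fin k → Chip (k * 2)) (hs : StrictMono s) (h : ∀ i, C (s i) = vert i 1)
      (hc : ∀ c, (∀ i, c ≠ s i) → C c = Vertex.center) : Stage C
  | twice (T : TwoColumn k) (h : ∀ i, (C (T.fst i) = vert i 1 ∧ C (T.snd i) = vert i 1) ∨
      (C (T.fst i) = Vertex.center ∧ C (T.snd i) = vert i 2)) : Stage C
  | final (T : TwoColumn k) (h : T.IsFinal C) : Stage C

/-! ### Invariance of the stages under firing -/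

namespace Stage

variable {k : ℕ} {C C' : Config k (k * 2)}

theorem fire_initial (h : ∀ c, C c = Vertex.center) (hf : Fire C C') : Stage C' := by
  obtain ⟨n, hn, hC, hmove, hstay⟩ | ⟨i, j, a, b, hab, ha, hb, hmovea, hmoveb, hstay⟩ := hf
  · exact .once n hn hmove fun c hc => (hstay c hc).trans (h c)
  · exact absurd ((h a).symm.trans ha) (center_ne_vert _ _)

/-- No branch vertex holds two chips, so only the center can fire. Its fire makes one pair on every
branch, and sorting each pair yields the two columns. -/
theorem fire_once {s : Fin k → Chip (k * 2)} (hs : StrictMono s) (h : ∀ i, C (s i) = vert i 1)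
    (hc : ∀ c, (∀ i, c ≠ s i) → C c = Vertex.center) (hf : Fire C C') : Stage C' := by
  obtain ⟨n, hn, hC, hmove, hstay⟩ | ⟨i, j, a, b, hab, ha, hb, hmovea, hmoveb, hstay⟩ := hf
  · have hsn : ∀ i j, s i ≠ n j := fun i j e =>
      center_ne_vert i 0 ((hC j).symm.trans (e ▸ h i))
    have hs' : ∀ i, C' (s i) = vert i 1 := fun i => (hstay _ (hsn i)).trans (h i)
    refine .twice ⟨fun i => min (s i) (n i), fun i => max (s i) (n i), fun i j hij => ?_,
      fun i j hij => ?_, fun i => ?_, fun i j => ?_⟩ fun i => Or.inl ⟨?_, ?_⟩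
    · exact min_lt_min (hs hij) (hn hij)
    · exact max_lt_max (hs hij) (hn hij)
    · exact min_lt_max.2 (hsn i i)
    · intro e
      rcases lt_trichotomy i j with hij | rfl | hij
      -- For `i < j` the chain `min (s i) (n i) ≤ s i < s j ≤ max (s j) (n j)` separates the
      -- entries.
      · exact absurd e ((min_le_left _ _).trans_lt ((hs hij).trans_le (le_max_left _ _))).ne
      · exact absurd e (min_lt_max.2 (hsn i i)).ne
      -- For `j < i` order does not help; distinctness of the chips in `s` and `n` does.
      · rcases min_choice (s i) (n i) with h1 | h1 <;> rcases max_choice (s j) (n j) with h2 | h2 <;>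
          rw [h1, h2] at e
        · exact hij.ne' (hs.injective e)
        · exact hsn _ _ e
        · exact hsn _ _ e.symm
        · exact hij.ne' (hn.injective e)
    · rcases min_choice (s i) (n i) with h1 | h1 <;> simp only [h1, hs', hmove]
    · rcases max_choice (s i) (n i) with h1 | h1 <;> simp only [h1, hs', hmove]
  · have key : ∀ c, C c = vert i (j + 1) → c = s i := by
      intro c hcv
      by_contra hne
      by_cases hcs : ∀ i, c ≠ s i
      · exact center_ne_vert i j ((hc c hcs).symm.trans hcv)
      · push Not at hcs
        obtain ⟨i', rfl⟩ := hcs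
        exact hne (by rw [(vert_succ_inj ((h i').symm.trans hcv)).1])
    exact absurd ((key a ha).trans (key b hb).symm) hab.ne

/-- Only chips of `fst` can be on the center. A center fire needs `k` of them, hence all, so every
branch has already fired. A branch fire can only split a pair still on level 1. -/
theorem fire_twice {T : TwoColumn k}
    (h : ∀ i, (C (T.fst i) = vert i 1 ∧ C (T.snd i) = vert i 1) ∨
      (C (T.fst i) = Vertex.center ∧ C (T.snd i) = vert i 2)) (hf : Fire C C') : Stage C' := by
  obtain ⟨n, hn, hC, hmove, hstay⟩ | ⟨i, j, a, b, hab, ha, hb, hmovea, hmoveb, hstay⟩ := hf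
  · have hex : ∀ i, ∃ i', T.fst i' = n i := by
      intro i
      obtain hi | ⟨i', hi'⟩ := T.cover (n i)
      · exact hi
      · have hcen := hC i
        rw [← hi'] at hcen
        rcases h i' with h' | h' <;> exact absurd (hcen.symm.trans h'.2) (center_ne_vert _ _)
    choose σ hσ using hex
    have hσm : StrictMono σ := fun i j hij => T.fst_mono.lt_iff_lt.1 (by rw [hσ, hσ]; exact hn hij)
    -- A strictly monotone self-map of `Fin k` is the identity, so each chip returns to its own
    -- branch.
    have hid : σ = id := (StrictMono.range_inj hσm strictMono_id).1
      (by rw [(Finite.injective_iff_surjective.1 hσm.injective).range_eq, Set.range_id])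
    have hn' : ∀ i, n i = T.fst i := fun i => by rw [← hσ, hid, id]
    refine .final T fun i => ⟨hn' i ▸ hmove i, ?_⟩
    rw [hstay _ fun j => by rw [hn']; exact (T.fst_ne_snd _ _).symm]
    rcases h i with h' | h'
    · exact absurd ((hn' i ▸ hC i : C (T.fst i) = _).symm.trans h'.1) (center_ne_vert _ _)
    · exact h'.2
  · have key : ∀ c, C c = vert i (j + 1) → (c = T.fst i ∨ c = T.snd i) ∧
        ((C (T.fst i) = vert i 1 ∧ C (T.snd i) = vert i 1) ∨ c ≠ T.fst i) := by
      intro c hcv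
      obtain ⟨i', rfl⟩ | ⟨i', rfl⟩ := T.cover c
      · rcases h i' with h' | h'
        · obtain ⟨rfl, rfl⟩ := vert_succ_inj (h'.1.symm.trans hcv)
          exact ⟨Or.inl rfl, Or.inl h'⟩
        · exact absurd (h'.1.symm.trans hcv) (center_ne_vert _ _)
      · refine ⟨?_, Or.inr (T.fst_ne_snd _ _).symm⟩
        rcases h i' with h' | h'
        · obtain ⟨rfl, rfl⟩ := vert_succ_inj (h'.2.symm.trans hcv)
          exact Or.inr rfl
        · obtain ⟨rfl, -⟩ := vert_succ_inj (h'.2.symm.trans hcv)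
          exact Or.inr rfl
    have hab' : a = T.fst i ∧ b = T.snd i := by
      have h1 := T.fst_lt_snd i
      rcases (key a ha).1 with rfl | rfl <;> rcases (key b hb).1 with rfl | rfl
      · exact absurd hab (lt_irrefl _)
      · exact ⟨rfl, rfl⟩
      · exact absurd hab h1.asymm
      · exact absurd hab (lt_irrefl _)
    obtain ⟨rfl, rfl⟩ := hab'
    -- Since `fst i` is on a branch vertex, branch `i` has not fired yet; this forces `j = 0`.
    have hi := (key _ ha).2.resolve_right (not_not.2 rfl)
    obtain ⟨-, rfl⟩ := vert_succ_inj (hi.1.symm.trans ha)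
    refine .twice T fun i' => ?_
    by_cases hii : i' = i
    · subst hii
      exact Or.inr ⟨hmovea, hmoveb⟩
    · rw [hstay _ (T.fst_mono.injective.ne hii) (T.fst_ne_snd _ _),
        hstay _ (T.fst_ne_snd _ _).symm (T.snd_mono.injective.ne hii)]
      exact h i'

theorem not_fire_final (hk : 1 ≤ k) {T : TwoColumn k} (h : T.IsFinal C) : ¬ Fire C C' := by
  rintro (⟨n, hn, hC, hmove, hstay⟩ | ⟨i, j, a, b, hab, ha, hb, hmovea, hmoveb, hstay⟩)
  · have hcen := hC ⟨0, hk⟩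
    obtain ⟨i, hi⟩ | ⟨i, hi⟩ := T.cover (n ⟨0, hk⟩) <;> rw [← hi] at hcen
    · exact center_ne_vert _ _ (hcen.symm.trans (h i).1)
    · exact center_ne_vert _ _ (hcen.symm.trans (h i).2)
  · have hav : (a : ℕ) ∈ chipsAt C (vert i (j + 1)) := ⟨a.2, ha⟩
    have hbv : (b : ℕ) ∈ chipsAt C (vert i (j + 1)) := ⟨b.2, hb⟩
    rw [TwoColumn.chipsAt_of_isFinal h] at hav hbv
    refine hab.ne (Subtype.ext ?_)
    split_ifs at hav hbv
    · exact hav.trans hbv.symm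
    · exact hav.trans hbv.symm
    · exact absurd hav (Set.notMem_empty _)

theorem fire (hk : 1 ≤ k) (h : Stage C) (hf : Fire C C') : Stage C' := by
  obtain h | ⟨s, hs, h, hc⟩ | ⟨T, h⟩ | ⟨T, h⟩ := h
  · exact fire_initial h hf
  · exact fire_once hs h hc hf
  · exact fire_twice h hf
  · exact absurd hf (not_fire_final hk h)

theorem of_reachable (hk : 1 ≤ k) (h : Reachable (start k 2) C) : Stage C := by
  induction h with
  | refl => exact .initial fun _ => rfl
  | tail _ hf ih => exact ih.fire hk hf

/-- Every earlier stage has an overfull vertex: the center with at least `k` chips, or level 1 of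
some branch with two. -/
theorem exists_isFinal (h : Stage C) (hC : Stable C) : ∃ T : TwoColumn k, T.IsFinal C := by
  have hcenter : ∀ f : Fin k → Chip (k * 2), Function.Injective f →
      ¬ ∀ i, C (f i) = Vertex.center := fun f hf hfC => by
    have h1 := le_ncard_chipsAt f hf hfC
    have h2 := hC Vertex.center
    rw [deg_center] at h2
    omega
  obtain h | ⟨s, hs, h, hc⟩ | ⟨T, h⟩ | ⟨T, h⟩ := h
  · exact absurd (fun i => h _)
      (hcenter (fun i => ⟨i + 1, by simp; omega⟩) fun i j hij => by simpa [Fin.ext_iff] using hij)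
  -- The `2k - k = k` chips not yet moved still fill the center.
  · have hcard : ((Finset.univ.image s)ᶜ).card = k := by
      rw [Finset.card_compl, Finset.card_image_of_injective _ hs.injective, card_chip]
      simp
      omega
    refine absurd (fun i => hc _ fun j hj => ?_) (hcenter (((Finset.univ.image s)ᶜ).orderEmbOfFin hcard)
      (RelEmbedding.injective _))
    have hm := Finset.orderEmbOfFin_mem ((Finset.univ.image s)ᶜ) hcard i
    rw [hj] at hm
    simp at hm
  · by_cases hall : ∀ i, C (T.fst i) = Vertex.center
    · exact absurd hall (hcenter _ T.fst_mono.injective)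
    · push Not at hall
      obtain ⟨i, hi⟩ := hall
      obtain ⟨h1, h2⟩ := (h i).resolve_right fun h' => hi h'.1
      have h3 := le_ncard_chipsAt (C := C) (v := vert i 1) ![T.fst i, T.snd i]
        (by
          intro x y hxy
          have := T.fst_ne_snd i i
          fin_cases x <;> fin_cases y <;> simp_all)
        (by intro x; fin_cases x <;> simp [h1, h2])
      have h4 := hC (vert i 1)
      rw [deg_branch i 0] at h4
      omega
  · exact ⟨T, h⟩

end Stage

theorem mem_stableConfigs_iff {k : ℕ} (hk : 1 ≤ k) {C : Config k (k * 2)} :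
    C ∈ stableConfigs k 2 ↔ ∃ T : TwoColumn k, T.IsFinal C :=
  ⟨fun h => (Stage.of_reachable hk h.1).exists_isFinal h.2, fun ⟨_, h⟩ =>
    ⟨TwoColumn.reachable_of_isFinal h, TwoColumn.stable_of_isFinal hk h⟩⟩

/-- A stable configuration is determined by the rows it exhibits on the branches. -/
noncomputable def stableConfigsEquiv {k : ℕ} (hk : 1 ≤ k) : TwoColumn k ≃ stableConfigs k 2 :=
  Equiv.ofBijective
    (fun T => ⟨T.place (vert · 1) (vert · 2), (mem_stableConfigs_iff hk).2 ⟨T, T.isFinal_place⟩⟩)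
    ⟨fun T T' h => T.isFinal_place.injective (by
      have h' := Subtype.ext_iff.1 h
      dsimp only at h'
      exact h' ▸ T'.isFinal_place), fun C => by
      obtain ⟨T, hT⟩ := (mem_stableConfigs_iff hk).1 C.2
      exact ⟨T, Subtype.ext (T.config_ext (fun i => by simp [(hT i).1])
        (fun i => by simp [(hT i).2]))⟩⟩

theorem isFinal_stableConfigsEquiv {k : ℕ} (hk : 1 ≤ k) (T : TwoColumn k) :
    T.IsFinal (stableConfigsEquiv hk T).1 :=
  T.isFinal_place

theorem rect_card (k m : ℕ) : (rect k m).card = k * m := by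
  have h : (rect k m).cells = Finset.range k ×ˢ Finset.range m := by
    ext ⟨i, j⟩
    rw [YoungDiagram.mem_cells, mem_rect]
    simp
  rw [YoungDiagram.card, h]
  simp

/-! ### Two-column fillings as standard Young tableaux -/

namespace TwoColumn

variable {k : ℕ}

/-- The entries of the tableau with rows `fst i < snd i`, and `0` outside the shape. -/
def entry (T : TwoColumn k) (i j : ℕ) : ℕ :=
  if h : i < k then (if j = 0 then (T.fst ⟨i, h⟩ : ℕ) else if j = 1 then T.snd ⟨i, h⟩ else 0) else 0

theorem entry_zero (T : TwoColumn k) (i : Fin k) : T.entry i 0 = T.fst i := by simp [entry]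

theorem entry_one (T : TwoColumn k) (i : Fin k) : T.entry i 1 = T.snd i := by simp [entry]

theorem entry_bijOn (T : TwoColumn k) : Set.BijOn (fun c : ℕ × ℕ => T.entry c.1 c.2)
    ((rect k 2).cells : Set (ℕ × ℕ)) (Set.Icc 1 (rect k 2).card) := by
  rw [rect_card]
  refine ⟨?_, ?_, ?_⟩
  · rintro ⟨i, j⟩ h
    obtain ⟨hi, hj⟩ := mem_rect.1 h
    lift i to Fin k using hi
    interval_cases j
    · simpa only [entry_zero] using (T.fst i).2
    · simpa only [entry_one] using (T.snd i).2
  · rintro ⟨i, j⟩ h ⟨i', j'⟩ h' e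
    obtain ⟨hi, hj⟩ := mem_rect.1 h
    obtain ⟨hi', hj'⟩ := mem_rect.1 h'
    lift i to Fin k using hi
    lift i' to Fin k using hi'
    dsimp only at e
    interval_cases j <;> interval_cases j' <;>
      simp only [entry_zero, entry_one] at e
    · rw [T.fst_mono.injective (Subtype.ext e)]
    · exact absurd (Subtype.ext e) (T.fst_ne_snd _ _)
    · exact absurd (Subtype.ext e.symm) (T.fst_ne_snd _ _)
    · rw [T.snd_mono.injective (Subtype.ext e)]
  · intro n hn
    obtain ⟨i, hi⟩ | ⟨i, hi⟩ := T.cover ⟨n, hn⟩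
    · exact ⟨(i, 0), mem_rect.2 ⟨i.2, by simp⟩, by simp [entry_zero, hi]⟩
    · exact ⟨(i, 1), mem_rect.2 ⟨i.2, by simp⟩, by simp [entry_one, hi]⟩

/-- The standard Young tableau with rows `fst i < snd i`. -/
def toTableau (T : TwoColumn k) : StandardYoungTableau (rect k 2) where
  entry := T.entry
  bijOn := T.entry_bijOn
  row_strict {i j₁ j₂} hj h := by
    obtain ⟨hi, hj₂⟩ := mem_rect.1 h
    obtain ⟨rfl, rfl⟩ : j₁ = 0 ∧ j₂ = 1 := by omega
    lift i to Fin k using hi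
    simpa only [entry_zero, entry_one] using Subtype.coe_lt_coe.2 (T.fst_lt_snd i)
  col_strict {i₁ i₂ j} hi h := by
    obtain ⟨hi₂, hj⟩ := mem_rect.1 h
    lift i₂ to Fin k using hi₂
    lift i₁ to Fin k using hi.trans i₂.2
    interval_cases j
    · simpa only [entry_zero] using Subtype.coe_lt_coe.2 (T.fst_mono hi)
    · simpa only [entry_one] using Subtype.coe_lt_coe.2 (T.snd_mono hi)
  zeros {i j} h := by
    rw [mem_rect, not_and] at h
    by_cases hi : i < k
    · have := h hi
      rw [entry, dif_pos hi, if_neg (by omega), if_neg (by omega)]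
    · rw [entry, dif_neg hi]

end TwoColumn

/-- The two columns of a standard Young tableau of shape `(2)^k`. -/
def StandardYoungTableau.toTwoColumn {k : ℕ} (Y : StandardYoungTableau (rect k 2)) :
    TwoColumn k where
  fst i := ⟨Y.entry i 0, by
    simpa only [rect_card] using Y.bijOn.mapsTo (x := ((i : ℕ), 0)) (mem_rect.2 ⟨i.2, by simp⟩)⟩
  snd i := ⟨Y.entry i 1, by
    simpa only [rect_card] using Y.bijOn.mapsTo (x := ((i : ℕ), 1)) (mem_rect.2 ⟨i.2, by simp⟩)⟩
  fst_mono _ j hij := Y.col_strict (j := 0) hij (mem_rect.2 ⟨j.2, by simp⟩)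
  snd_mono _ j hij := Y.col_strict (j := 1) hij (mem_rect.2 ⟨j.2, by simp⟩)
  fst_lt_snd i := Y.row_strict zero_lt_one (mem_rect.2 ⟨i.2, by simp⟩)
  fst_ne_snd i j h := by
    have := Y.bijOn.injOn (x₁ := ((i : ℕ), 0)) (x₂ := ((j : ℕ), 1)) (mem_rect.2 ⟨i.2, by simp⟩)
      (mem_rect.2 ⟨j.2, by simp⟩) (Subtype.ext_iff.1 h)
    simp at this

/-- Standard Young tableaux of shape `(2)^k` are given by their two columns. -/
def tableauEquiv (k : ℕ) : TwoColumn k ≃ StandardYoungTableau (rect k 2) where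
  toFun := TwoColumn.toTableau
  invFun := StandardYoungTableau.toTwoColumn
  left_inv T := by
    ext i
    · exact T.entry_zero i
    · exact T.entry_one i
  right_inv Y := by
    ext i j
    change Y.toTwoColumn.entry i j = Y.entry i j
    by_cases h : (i, j) ∈ rect k 2
    · obtain ⟨hi, hj⟩ := mem_rect.1 h
      lift i to Fin k using hi
      interval_cases j
      · exact TwoColumn.entry_zero _ i
      · exact TwoColumn.entry_one _ i
    · exact (Y.toTwoColumn.toTableau.zeros h).trans (Y.zeros h).symm

theorem tableauEquiv_entry {k : ℕ} (T : TwoColumn k) : (tableauEquiv k T).entry = T.entry := rfl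

/-! ### Counting by Dyck words -/

open DyckStep

/-- Position `n` of a word, counted from 0, belongs to label `n + 1`, so the prefix of length `n`
covers the labels `1, …, n`. Injectivity of `f` makes each occurrence count once. -/
theorem count_take_eq_card {k : ℕ} {l : List DyckStep} {x : DyckStep} {f : Fin k → ℕ}
    (hf : Function.Injective f) (hpos : ∀ i, 1 ≤ f i)
    (hl : ∀ n, l[n]? = some x ↔ ∃ i, f i = n + 1) (n : ℕ) :
    (l.take n).count x = (Finset.univ.filter fun i => f i ≤ n).card := by
  induction n with
  | zero =>
    rw [List.take_zero, List.count_nil, eq_comm, Finset.card_eq_zero, Finset.filter_eq_empty_iff]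
    intro i _
    have := hpos i
    omega
  | succ n ih =>
    rw [List.take_add_one, List.count_append, ih]
    by_cases h : l[n]? = some x
    · obtain ⟨i, hi⟩ := (hl n).1 h
      have : (Finset.univ.filter fun i => f i ≤ n + 1) =
          insert i (Finset.univ.filter fun i => f i ≤ n) := by
        ext i'
        simp only [Finset.mem_filter, Finset.mem_univ, true_and, Finset.mem_insert]
        have : i' = i ↔ f i' = n + 1 := ⟨fun e => e ▸ hi, fun e => hf (e.trans hi.symm)⟩
        omega
      rw [this, Finset.card_insert_of_notMem (by simp [hi]), h]
      simp
    · have : (Finset.univ.filter fun i => f i ≤ n + 1) = Finset.univ.filter fun i => f i ≤ n := by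
        refine Finset.filter_congr fun i _ => ?_
        have : f i ≠ n + 1 := fun e => h ((hl n).2 ⟨i, e⟩)
        omega
      rw [this]
      rcases h' : l[n]? with _ | y
      · simp
      · have : y ≠ x := fun e => h (h'.trans (congrArg some e))
        simp [this]

namespace TwoColumn

variable {k : ℕ}

open Classical in
/-- The word with up-steps at the positions in the first column. -/
noncomputable def word (T : TwoColumn k) : List DyckStep :=
  List.ofFn fun n : Fin (k * 2) => if ∃ i, (T.fst i : ℕ) = n + 1 then U else D

theorem length_word (T : TwoColumn k) : T.word.length = k * 2 := by simp [word]

theorem getElem?_word_eq_U (T : TwoColumn k) (n : ℕ) :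
    T.word[n]? = some U ↔ ∃ i, (T.fst i : ℕ) = n + 1 := by
  by_cases hn : n < k * 2
  · rw [List.getElem?_eq_getElem (by rwa [length_word])]
    by_cases h : ∃ i, (T.fst i : ℕ) = n + 1 <;> simp [word, h]
  · rw [List.getElem?_eq_none (by rw [length_word]; omega)]
    simp only [reduceCtorEq, false_iff, not_exists]
    intro i hi
    have := (T.fst i).2.2
    omega

theorem getElem?_word_eq_D (T : TwoColumn k) (n : ℕ) :
    T.word[n]? = some D ↔ ∃ i, (T.snd i : ℕ) = n + 1 := by
  by_cases hn : n < k * 2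
  · have hU := T.getElem?_word_eq_U n
    rw [List.getElem?_eq_getElem (by rwa [length_word])] at hU ⊢
    rw [Option.some_inj] at hU ⊢
    have hD : T.word[n]'(by rwa [length_word]) = D ↔ ¬ T.word[n]'(by rwa [length_word]) = U := by
      rcases (T.word[n]'(by rwa [length_word])).dichotomy with h | h <;> simp [h]
    rw [hD, hU]
    constructor
    · intro h
      obtain ⟨i, hi⟩ | ⟨i, hi⟩ := T.cover ⟨n + 1, by simp; omega⟩
      · exact absurd ⟨i, by rw [hi]⟩ h
      · exact ⟨i, by rw [hi]⟩
    · rintro ⟨i, hi⟩ ⟨j, hj⟩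
      exact T.fst_ne_snd j i (Subtype.ext (hj.trans hi.symm))
  · rw [List.getElem?_eq_none (by rw [length_word]; omega)]
    simp only [reduceCtorEq, false_iff, not_exists]
    intro i hi
    have := (T.snd i).2.2
    omega

theorem count_U_take_word (T : TwoColumn k) (n : ℕ) :
    (T.word.take n).count U = (Finset.univ.filter fun i => (T.fst i : ℕ) ≤ n).card :=
  count_take_eq_card (Subtype.val_injective.comp T.fst_mono.injective) (fun i => (T.fst i).2.1)
    T.getElem?_word_eq_U n

theorem count_D_take_word (T : TwoColumn k) (n : ℕ) :
    (T.word.take n).count D = (Finset.univ.filter fun i => (T.snd i : ℕ) ≤ n).card :=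
  count_take_eq_card (Subtype.val_injective.comp T.snd_mono.injective) (fun i => (T.snd i).2.1)
    T.getElem?_word_eq_D n

theorem count_U_word (T : TwoColumn k) : T.word.count U = k := by
  have h := T.count_U_take_word (k * 2)
  rwa [List.take_of_length_le T.length_word.le,
    Finset.filter_true_of_mem fun i _ => (T.fst i).2.2, Finset.card_univ, Fintype.card_fin] at h

theorem count_D_word (T : TwoColumn k) : T.word.count D = k := by
  have h := T.count_D_take_word (k * 2)
  rwa [List.take_of_length_le T.length_word.le,
    Finset.filter_true_of_mem fun i _ => (T.snd i).2.2, Finset.card_univ, Fintype.card_fin] at h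

/-- The Dyck word with up-steps at the positions in the first column. -/
noncomputable def dyckWord (T : TwoColumn k) : DyckWord where
  toList := T.word
  count_U_eq_count_D := T.count_U_word.trans T.count_D_word.symm
  count_D_le_count_U n := by
    rw [count_U_take_word, count_D_take_word]
    -- If `snd i` lies in the prefix, so does the smaller `fst i`.
    refine Finset.card_le_card (Finset.monotone_filter_right _ fun i _ hi => ?_)
    exact (Subtype.coe_le_coe.2 (T.fst_lt_snd i).le).trans hi

/-- The word determines the set of entries of each column, and a strictly monotone sequence is
determined by its range. -/
theorem word_injective : Function.Injective (word : TwoColumn k → List DyckStep) := by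
  intro T T' h
  have hr : ∀ {f g : Fin k → Chip (k * 2)}, StrictMono f → StrictMono g →
      (∀ n : ℕ, (∃ i, (f i : ℕ) = n + 1) ↔ ∃ i, (g i : ℕ) = n + 1) → f = g := by
    intro f g hf hg hfg
    refine (StrictMono.range_inj hf hg).1 (Set.ext fun ⟨c, hc⟩ => ?_)
    obtain ⟨n, rfl⟩ : ∃ n, c = n + 1 := ⟨c - 1, by have := hc.1; omega⟩
    simpa [Subtype.ext_iff] using hfg n
  ext1
  · exact hr T.fst_mono T'.fst_mono fun n => by
      rw [← getElem?_word_eq_U, ← getElem?_word_eq_U, h]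
  · exact hr T.snd_mono T'.snd_mono fun n => by
      rw [← getElem?_word_eq_D, ← getElem?_word_eq_D, h]

theorem exists_strictMono_of_count {k : ℕ} {l : List DyckStep} (hl : l.length = k * 2)
    {x : DyckStep} (hx : l.count x = k) : ∃ f : Fin k → Chip (k * 2), StrictMono f ∧
      ∀ n, l[n]? = some x ↔ ∃ i, (f i : ℕ) = n + 1 := by
  -- Labels are at least 1, so the subtraction is never truncated.
  set s : Finset (Chip (k * 2)) := Finset.univ.filter fun c => l[(c : ℕ) - 1]? = some x with hs
  have key : ∀ n, l[n]? = some x ↔ ∃ i, ((s.orderEmbOfFin rfl i : Chip (k * 2)) : ℕ) = n + 1 := by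
    intro n
    have hrange := Finset.range_orderEmbOfFin s rfl
    constructor
    · intro h
      have hn : n < k * 2 := by
        by_contra hn
        rw [List.getElem?_eq_none (by omega)] at h
        cases h
      have hmem : (⟨n + 1, by simp; omega⟩ : Chip (k * 2)) ∈ (s : Set (Chip (k * 2))) := by
        simpa [hs] using h
      rw [← hrange] at hmem
      obtain ⟨i, hi⟩ := hmem
      exact ⟨i, by rw [hi]⟩
    · rintro ⟨i, hi⟩
      have hm := (Finset.mem_filter.1 (Finset.orderEmbOfFin_mem s rfl i)).2
      rwa [hi, Nat.add_sub_cancel] at hm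
  -- `key`, still indexed by `Fin s.card`, lets the letter count of the whole word compute `s.card`.
  have hcard : s.card = k := by
    have h := count_take_eq_card
      (Subtype.val_injective.comp (s.orderEmbOfFin rfl).injective)
      (fun i => (s.orderEmbOfFin rfl i).2.1) key (k * 2)
    simp only [Function.comp_apply] at h
    rwa [List.take_of_length_le hl.le, hx,
      Finset.filter_true_of_mem fun i _ => (s.orderEmbOfFin rfl i).2.2, Finset.card_univ,
      Fintype.card_fin, eq_comm] at h
  refine ⟨fun i => s.orderEmbOfFin rfl (Fin.cast hcard.symm i),
    fun i j hij => (s.orderEmbOfFin rfl).strictMono (by simpa using hij), fun n => (key n).trans ?_⟩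
  exact (finCongr hcard).exists_congr_left

theorem exists_word_eq (p : DyckWord) (hp : p.semilength = k) :
    ∃ T : TwoColumn k, T.word = p.toList := by
  have hlen : p.toList.length = k * 2 := by
    rw [← p.two_mul_semilength_eq_length, hp, mul_comm]
  obtain ⟨a, ha, haU⟩ := exists_strictMono_of_count hlen hp
  obtain ⟨b, hb, hbD⟩ := exists_strictMono_of_count hlen (p.semilength_eq_count_D.symm.trans hp)
  have hne : ∀ i j, a i ≠ b j := by
    intro i j h
    obtain ⟨n, hn⟩ : ∃ n, (a i : ℕ) = n + 1 := ⟨a i - 1, by have := (a i).2.1; omega⟩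
    have h1 := (haU n).2 ⟨i, hn⟩
    have h2 := (hbD n).2 ⟨j, h ▸ hn⟩
    simp [h1] at h2
  -- If `b i < a i`, consider the prefix of length `b i`. Any `a j` in it has `j < i`, so `b j` is
  -- in it too, while `b i` is in it and `a i` is not: more down-steps than up-steps, against the
  -- Dyck condition.
  have hlt : ∀ i, a i < b i := by
    intro i
    by_contra hi
    have hi' : b i < a i := lt_of_le_of_ne (not_lt.1 hi) (hne i i).symm
    have h := p.count_D_le_count_U (b i)
    rw [count_take_eq_card (Subtype.val_injective.comp ha.injective) (fun i => (a i).2.1) haU,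
      count_take_eq_card (Subtype.val_injective.comp hb.injective) (fun i => (b i).2.1) hbD] at h
    refine absurd h (not_le.2 (Finset.card_lt_card (Finset.ssubset_iff_of_subset ?_ |>.2
      ⟨i, by simp, ?_⟩)))
    · intro j hj
      simp only [Finset.mem_filter, Finset.mem_univ, true_and, Function.comp_apply,
        Subtype.coe_le_coe] at hj ⊢
      exact (hb (ha.lt_iff_lt.1 (hj.trans_lt hi'))).le
    · simpa using hi'
  let T : TwoColumn k := ⟨a, b, ha, hb, hlt, hne⟩
  refine ⟨T, List.ext_getElem? fun n => Option.ext fun x => ?_⟩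
  rcases x.dichotomy with rfl | rfl
  · exact (T.getElem?_word_eq_U n).trans (haU n).symm
  · exact (T.getElem?_word_eq_D n).trans (hbD n).symm

/-- Pairs of columns correspond to Dyck words. -/
noncomputable def dyckWordEquiv (k : ℕ) : TwoColumn k ≃ {p : DyckWord // p.semilength = k} :=
  Equiv.ofBijective (fun T => ⟨T.dyckWord, T.count_U_word⟩)
    ⟨fun _ _ h => word_injective (congrArg DyckWord.toList (Subtype.ext_iff.1 h)), fun ⟨p, hp⟩ => by
      obtain ⟨T, hT⟩ := exists_word_eq p hp
      exact ⟨T, Subtype.ext (DyckWord.ext hT)⟩⟩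

theorem natCard_eq_catalan (k : ℕ) : Nat.card (TwoColumn k) = catalan k := by
  rw [Nat.card_congr (dyckWordEquiv k), Nat.card_eq_fintype_card,
    DyckWord.card_dyckWord_semilength_eq_catalan]

end TwoColumn

end StarChip

theorem theorem5p1 (k : ℕ) (hk : 1 ≤ k) :
    (∃ φ : StarChip.stableConfigs k 2 ≃ StarChip.StandardYoungTableau (StarChip.rect k 2),
      (∀ (C : StarChip.stableConfigs k 2) (i : Fin k) (j : Fin 2),
        StarChip.chipsAt C.1 (StarChip.vert i (j + 1)) = {(φ C).entry i j}) ∧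
      (∀ (Y : StarChip.StandardYoungTableau (StarChip.rect k 2)) (i : Fin k) (j : ℕ),
        StarChip.chipsAt (φ.symm Y).1 (StarChip.vert i j) =
          if 1 ≤ j ∧ j ≤ 2 then {Y.entry i (j - 1)} else ∅)) ∧
    Nat.card (StarChip.StandardYoungTableau (StarChip.rect k 2)) = catalan k ∧
    Nat.card (StarChip.stableConfigs k 2) = catalan k := by
  -- Levels start at 1 and columns at 0, hence `j - 1`; the guard `1 ≤ j` excludes truncation at the
  -- center.
  have key : ∀ (T : StarChip.TwoColumn k) (i : Fin k) (j : ℕ),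
      StarChip.chipsAt (StarChip.stableConfigsEquiv hk T).1 (StarChip.vert i j) =
        if 1 ≤ j ∧ j ≤ 2 then {(StarChip.tableauEquiv k T).entry i (j - 1)} else ∅ := by
    intro T i j
    rw [StarChip.TwoColumn.chipsAt_of_isFinal (StarChip.isFinal_stableConfigsEquiv hk T)]
    obtain rfl | rfl | hj : j = 1 ∨ j = 2 ∨ ¬ (1 ≤ j ∧ j ≤ 2) := by omega
    · simp [StarChip.tableauEquiv_entry, StarChip.TwoColumn.entry_zero]
    · simp [StarChip.tableauEquiv_entry, StarChip.TwoColumn.entry_one]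
    · rw [if_neg (by omega), if_neg (by omega), if_neg hj]
  refine ⟨⟨(StarChip.stableConfigsEquiv hk).symm.trans (StarChip.tableauEquiv k), fun C i j => ?_,
    fun Y i j => ?_⟩, ?_, ?_⟩
  · have h := key ((StarChip.stableConfigsEquiv hk).symm C) i (j + 1)
    rwa [Equiv.apply_symm_apply, if_pos (by omega), Nat.add_sub_cancel] at h
  · have h := key ((StarChip.tableauEquiv k).symm Y) i j
    rwa [Equiv.apply_symm_apply] at h
  · rw [← Nat.card_congr (StarChip.tableauEquiv k), StarChip.TwoColumn.natCard_eq_catalan]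
  · rw [← Nat.card_congr (StarChip.stableConfigsEquiv hk), StarChip.TwoColumn.natCard_eq_catalan]
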